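/- \textbf{Definitions.} Let $K$ be a finite simplicial complex that is a piecewise linear (PL) triangulation of the sphere $S^{k-1}$ (for $k=0$: the empty complex). The $k$-dimensional \emph{simple cell} dual to $K$ is the cone over the barycentric subdivision of $K$, a closed PL $k$-disk; for each simplex $\tau$ of $K$ with $m\ge 1$ vertices it has a face of dimension $k-m$, namely the subcomplex spanned by the barycenters of the simplices of $K$ containing $\tau$, and the whole cell is regarded as the face corresponding to $\tau=\emptyset$. A \emph{decomposition} of a Hausdorff space $Z$ \emph{into simple cells} is a finite set of closed subsets of $Z$ (cells), each equipped with a homeomorphism (chart) from a simple cell, such that: the cells contained in a given cell are exactly its faces, with the dimensions given above; $Z$ is the disjoint union of the relative interiors of the cells; and the PL structure of every cell restricts to the PL structure of each of its faces. An \emph{isomorphism} between two cells is a PL homeomorphism (with respect to the charts) carrying faces onto faces. A space $Z$ decomposed into simple cells is an $n$-dimensional (closed) \emph{pseudo-manifold} if every cell is contained in an $n$-dimensional cell and every $(n-1)$-dimensional cell is contained in exactly two $n$-dimensional cells. It is \emph{strongly connected} if any two $n$-dimensional cells can be joined by a sequence of $n$-dimensional cells in which consecutive ones contain a common $(n-1)$-dimensional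 cell. A \emph{labeling} assigns to each $(n-1)$-dimensional cell an element of a finite set. For a cell $F$ let $c(F)$ be the set of labels of the $(n-1)$-dimensional cells containing $F$. The labeling is \emph{good} if (1) $|c(F)|=n-\dim F$ for every cell $F$, and (2) for every cell $F$ and every $n$-dimensional cell $G\supseteq F$, the labels of all $(n-1)$-dimensional cells $H$ with $F\subseteq H\subseteq G$ are pairwise distinct. \textbf{Lemma.} Let $Z$ be an $n$-dimensional pseudo-manifold decomposed into simple cells. Then there are an $n$-dimensional pseudo-manifold $\overline{Z}$ decomposed into simple cells which admits a good labeling, and a continuous surjective map $p:\overline{Z}\to Z$ such that $p$ is a covering over the complement of the codimension-$2$ skeleton of $Z$ (the union of the cells of dimension at most $n-2$) and $p$ maps each cell of $\overline{Z}$ isomorphically onto a cell of $Z$. If $Z$ is strongly connected, then $\overline{Z}$ can moreover be chosen strongly connected. -/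

import Mathlib

universe u

open Set

/-- `f` is piecewise linear on the compact polyhedron `X`: the set `X` is a finite union of
polytopes (convex hulls of finite sets) on each of which `f` agrees with an affine map.
(Since the polytopes are closed and finitely many, `f` is then continuous on `X`.) -/
def IsPLOn {E F : Type*} [AddCommGroup E] [Module ℝ E] [AddCommGroup F] [Module ℝ F]
    (f : E → F) (X : Set E) : Prop :=
  ∃ (m : ℕ) (P : Fin m → Finset E),
    X = ⋃ i, convexHull ℝ (P i : Set E) ∧
    ∀ i, ∃ a : E →ᵃ[ℝ] F, EqOn f a (convexHull ℝ (P i : Set E))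

/-- The geometric realization of a finite abstract simplicial complex, in barycentric
coordinates: the points of the standard simplex whose support is contained in a simplex. -/
def realization {V : Type*} [Fintype V] (K : AbstractSimplicialComplex V) : Set (V → ℝ) :=
  {x | x ∈ stdSimplex ℝ V ∧ ∃ σ ∈ K, ∀ v, x v ≠ 0 → v ∈ σ}

/-- The boundary of the standard `k`-dimensional simplex. It is the standard piecewise linear
sphere of dimension `k - 1` (the empty set if `k = 0`). -/
def simplexBoundary (k : ℕ) : Set (Fin (k + 1) → ℝ) :=
  {x | x ∈ stdSimplex ℝ (Fin (k + 1)) ∧ ∃ i, x i = 0}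

/-- `K` is a piecewise linear triangulation of the sphere of dimension `k - 1`: its realization
is piecewise linearly homeomorphic to the boundary of the `k`-simplex. (A piecewise linear
bijection of compact polyhedra is a homeomorphism with piecewise linear inverse.) -/
def IsPLSphere {V : Type*} [Fintype V] (K : AbstractSimplicialComplex V) (k : ℕ) : Prop :=
  ∃ f : (V → ℝ) → (Fin (k + 1) → ℝ),
    IsPLOn f (realization K) ∧ BijOn f (realization K) (simplexBoundary k)

/-- The simplices of `K` together with the empty simplex. They index the faces of the cell
dual to `K`; the empty simplex corresponds to the whole cell. -/
def augmentedFaces {V : Type*} (K : AbstractSimplicialComplex V) : Set (Finset V) :=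
  {σ | σ = ∅ ∨ σ ∈ K}

/-- The cone over the barycentric subdivision of `K`, realized in barycentric coordinates. Its
vertices are the barycenters of the simplices of `K` and the apex, which is indexed by the empty
simplex; its simplices are the chains with respect to inclusion. -/
def dualCell {V : Type*} [Fintype V] (K : AbstractSimplicialComplex V) : Set (Finset V → ℝ) :=
  {x | x ∈ stdSimplex ℝ (Finset V) ∧ (∀ σ, x σ ≠ 0 → σ ∈ augmentedFaces K) ∧
    IsChain (· ⊆ ·) {σ | x σ ≠ 0}}

/-- The face of the dual cell which is dual to the simplex `τ`: the part of the barycentric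
subdivision spanned by the barycenters of the simplices containing `τ`. -/
def dualFace {V : Type*} [Fintype V] (K : AbstractSimplicialComplex V) (τ : Finset V) :
    Set (Finset V → ℝ) :=
  {x | x ∈ dualCell K ∧ ∀ σ, x σ ≠ 0 → τ ⊆ σ}

/-- A simple cell in a topological space `X`: a closed disk of dimension `dim` embedded in `X`,
given by a chart from the cell dual to a piecewise linear triangulation `link` of the sphere of
dimension `dim - 1`. The vertices of `link` correspond to the facets of the cell. -/
structure SimpleCell (X : Type*) [TopologicalSpace X] where
  dim : ℕ
  numFacets : ℕ
  link : AbstractSimplicialComplex (Fin numFacets)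
  isPLSphere_link : IsPLSphere link dim
  chart : dualCell link → X
  isEmbedding_chart : Topology.IsEmbedding chart

namespace SimpleCell

variable {X Y : Type*} [TopologicalSpace X] [TopologicalSpace Y]

/-- The closed cell as a subset of `X`. -/
def carrier (P : SimpleCell X) : Set X := range P.chart

/-- The closed face of the cell dual to the simplex `τ`. -/
def face (P : SimpleCell X) (τ : Finset (Fin P.numFacets)) : Set X :=
  P.chart '' {x | (x : Finset (Fin P.numFacets) → ℝ) ∈ dualFace P.link τ}

/-- The relative interior of the cell: the complement of all proper faces. -/
def relInterior (P : SimpleCell X) : Set X :=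
  P.carrier \ ⋃ τ ∈ P.link, P.face τ

/-- `p` maps the simple cell `P` isomorphically onto the simple cell `Q`: in the charts it is a
piecewise linear homeomorphism, and it carries the faces of `P` onto the faces of `Q`. -/
def MapsIso (p : X → Y) (P : SimpleCell X) (Q : SimpleCell Y) : Prop :=
  (∃ g : (Finset (Fin P.numFacets) → ℝ) → (Finset (Fin Q.numFacets) → ℝ),
    ∃ hg : BijOn g (dualCell P.link) (dualCell Q.link),
      IsPLOn g (dualCell P.link) ∧
      ∀ x : dualCell P.link, p (P.chart x) = Q.chart ⟨g x, hg.mapsTo x.2⟩) ∧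
  {A | ∃ τ ∈ augmentedFaces P.link, A = p '' P.face τ} =
    {A | ∃ τ ∈ augmentedFaces Q.link, A = Q.face τ}

end SimpleCell

/-- A finite decomposition of the space `X` into simple cells (distinct indices have distinct
closed cells). -/
structure SimpleCellDecomposition (X : Type*) [TopologicalSpace X] where
  Cell : Type
  finite_cell : Finite Cell
  cell : Cell → SimpleCell X
  carrier_injective : Function.Injective fun i => (cell i).carrier
  /-- The face of a cell of dimension `k` dual to a simplex with `m` vertices is itself a cell of
  the decomposition, and it has dimension `k - m`. -/
  face_mem : ∀ j, ∀ τ ∈ augmentedFaces (cell j).link,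
    ∃ i, (cell i).carrier = (cell j).face τ ∧ (cell i).dim + τ.card = (cell j).dim
  /-- Every cell contained in a cell is one of its faces. -/
  eq_face : ∀ i j, (cell i).carrier ⊆ (cell j).carrier →
    ∃ τ ∈ augmentedFaces (cell j).link, (cell i).carrier = (cell j).face τ
  /-- The space is the disjoint union of the relative interiors of the cells. -/
  existsUnique_mem : ∀ x, ∃! i, x ∈ (cell i).relInterior
  /-- The piecewise linear structure of a cell restricts to those of its faces. -/
  transition : ∀ i j, (cell i).carrier ⊆ (cell j).carrier →
    ∃ g : (Finset (Fin (cell i).numFacets) → ℝ) → (Finset (Fin (cell j).numFacets) → ℝ),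
      ∃ hg : MapsTo g (dualCell (cell i).link) (dualCell (cell j).link),
        IsPLOn g (dualCell (cell i).link) ∧
        ∀ x : dualCell (cell i).link, (cell i).chart x = (cell j).chart ⟨g x, hg x.2⟩

namespace SimpleCellDecomposition

variable {X : Type*} [TopologicalSpace X] (D : SimpleCellDecomposition X)

/-- The dimension of a cell. -/
def dim (F : D.Cell) : ℕ := (D.cell F).dim

/-- The cell `F` is contained in the cell `G` (possibly `F = G`). -/
def Sub (F G : D.Cell) : Prop := (D.cell F).carrier ⊆ (D.cell G).carrier

/-- The (closed) `n`-dimensional pseudo-manifold condition: every cell is contained in an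
`n`-dimensional cell, and every `(n-1)`-dimensional cell is contained in exactly two
`n`-dimensional cells. -/
structure IsPseudoManifold (n : ℕ) : Prop where
  exists_top : ∀ F : D.Cell, ∃ G, D.dim G = n ∧ D.Sub F G
  ncard_top : ∀ H : D.Cell, D.dim H + 1 = n → {G | D.dim G = n ∧ D.Sub H G}.ncard = 2

/-- Any two `n`-dimensional cells are joined by a sequence of `n`-dimensional cells in which
consecutive ones have a common `(n-1)`-dimensional cell. -/
def IsStronglyConnected (n : ℕ) : Prop :=
  ∀ G G' : D.Cell, D.dim G = n → D.dim G' = n →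
    Relation.ReflTransGen
      (fun A B => D.dim A = n ∧ D.dim B = n ∧ ∃ H, D.dim H + 1 = n ∧ D.Sub H A ∧ D.Sub H B) G G'

/-- The skeleton of codimension `2`: the union of the cells of dimension at most `n - 2`. -/
def codimTwoSkeleton (n : ℕ) : Set X :=
  ⋃ (F : D.Cell) (_ : D.dim F + 2 ≤ n), (D.cell F).carrier

/-- The cells of dimension `n - 1`. -/
def Facet (n : ℕ) : Type := {H : D.Cell // D.dim H + 1 = n}

variable {D} in
/-- The label `c(F)` of a cell: the set of labels of the `(n-1)`-dimensional cells
containing it. -/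
def labelSet {n : ℕ} {α : Type*} (l : D.Facet n → α) (F : D.Cell) : Set α :=
  l '' {H | D.Sub F H.1}

variable {D} in
/-- A labeling of the `(n-1)`-dimensional cells is good if `|c(F)| = n - dim F` for every cell
`F`, and for every cell `F` and `n`-dimensional cell `G ⊇ F` the labels of the
`(n-1)`-dimensional cells `H` with `F ⊆ H ⊆ G` are pairwise distinct. -/
def IsGoodLabeling {n : ℕ} {α : Type*} (l : D.Facet n → α) : Prop :=
  (∀ F : D.Cell, (labelSet l F).ncard + D.dim F = n) ∧
  ∀ F G : D.Cell, D.dim G = n → D.Sub F G → InjOn l {H | D.Sub F H.1 ∧ D.Sub H.1 G}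

end SimpleCellDecomposition

/-! ### Faces of a simple cell -/

/-! In a simple cell, the face dual to a simplex with `m` vertices lies in exactly `m` facets
(`ncard_facetsBetween`). Hence within one `n`-cell any injective labeling of the facets is good. The
obstruction is monodromy: labels carried from cell to cell across facets need not return to
themselves. The cover removes it by using all labelings at once.

A sheet is a pair `(G, a)` of an `n`-cell and a permutation `a` of the set of all facets, where `a`
labels the facets of `G`. The facets of `G` other than `H` that meet `H` in codimension two
correspond to the codimension-two cells of `H`, in the same way for every `G ⊇ H`
(`exists_facets_param`). So there are permutations `ψ H G` carrying a set `S H F`, independent of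
`G`, to the facets between `F` and `G`, for every `F ⊆ H` (`exists_perm_facets`). Glue `(G, a)` to
`(G', b)` along `H` when `a ∘ ψ H G = b ∘ ψ H G'`. Each gluing along a facet containing `F` then
preserves the set of labels of the facets over `F`, so this set, of size `n - dim F`, is constant on
every class of sheets around `F` (`labelSet_eq`).

A point of the covering space is a point `x` of `Z` with a class of sheets modulo gluings along the
facets through `x`. Off the codimension-two skeleton at most one facet passes through `x`, whence
the covering property. For strong connectedness, one component of the sheets suffices
(`exists_connected`). -/

theorem IsPLOn.isCompact {ι : Type*} {F : Type*} [AddCommGroup F] [Module ℝ F]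
    {f : (ι → ℝ) → F} {X : Set (ι → ℝ)} (h : IsPLOn f X) : IsCompact X := by
  obtain ⟨m, P, rfl, -⟩ := h
  exact isCompact_iUnion fun i => (P i).finite_toSet.isCompact_convexHull ℝ

section DualCell

variable {V : Type*} {K : AbstractSimplicialComplex V} {σ τ : Finset V}

theorem mem_augmentedFaces_of_subset (hσ : σ ∈ augmentedFaces K) (h : τ ⊆ σ) :
    τ ∈ augmentedFaces K := by
  rcases τ.eq_empty_or_nonempty with rfl | hτ
  · exact Or.inl rfl
  · rcases hσ with rfl | hσ
    · exact Or.inl (Finset.subset_empty.1 h)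
    · exact Or.inr ((K.isRelLowerSet_faces hσ).2 h hτ)

open Classical in
/-- The barycenter of the simplex `σ`, as a vertex of the dual cell. -/
noncomputable def barycenterVertex (σ : Finset V) : Finset V → ℝ := Pi.single σ 1

theorem barycenterVertex_ne_zero : barycenterVertex σ τ ≠ 0 ↔ τ = σ := by
  classical
  unfold barycenterVertex
  by_cases h : τ = σ
  · subst h; simp
  · simp [h]

variable [Fintype V]

theorem barycenterVertex_mem_dualCell (hσ : σ ∈ augmentedFaces K) :
    barycenterVertex σ ∈ dualCell K := by
  classical
  refine ⟨single_mem_stdSimplex ℝ σ, ?_, ?_⟩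
  · rintro ρ hρ
    rwa [barycenterVertex_ne_zero.1 hρ]
  · intro a ha b hb hab
    exact absurd ((barycenterVertex_ne_zero.1 ha).trans (barycenterVertex_ne_zero.1 hb).symm) hab

theorem barycenterVertex_mem_dualFace (hσ : σ ∈ augmentedFaces K) :
    barycenterVertex σ ∈ dualFace K τ ↔ τ ⊆ σ := by
  refine ⟨fun h => h.2 σ (barycenterVertex_ne_zero.2 rfl), fun h =>
    ⟨barycenterVertex_mem_dualCell hσ, fun ρ hρ => ?_⟩⟩
  rwa [barycenterVertex_ne_zero.1 hρ]

theorem dualFace_subset_dualFace_iff (hτ : τ ∈ augmentedFaces K) :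
    dualFace K τ ⊆ dualFace K σ ↔ σ ⊆ τ :=
  ⟨fun h => (barycenterVertex_mem_dualFace hτ).1 (h ((barycenterVertex_mem_dualFace hτ).2 subset_rfl)),
    fun h _ hx => ⟨hx.1, fun ρ hρ => h.trans (hx.2 ρ hρ)⟩⟩

end DualCell

namespace SimpleCell

variable {X : Type*} [TopologicalSpace X] (P : SimpleCell X) {σ τ : Finset (Fin P.numFacets)}

theorem face_subset_carrier (τ : Finset (Fin P.numFacets)) : P.face τ ⊆ P.carrier :=
  image_subset_range _ _

theorem face_subset_face_iff (hτ : τ ∈ augmentedFaces P.link) :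
    P.face τ ⊆ P.face σ ↔ σ ⊆ τ := by
  rw [← dualFace_subset_dualFace_iff hτ, face, face,
    image_subset_image_iff P.isEmbedding_chart.injective]
  exact ⟨fun h x hx => h (a := ⟨x, hx.1⟩) hx, fun h x hx => h hx⟩

theorem face_empty : P.face ∅ = P.carrier := by
  rw [face, carrier, ← image_univ]
  congr 1
  ext x
  simp only [mem_ofPred_eq, mem_univ, iff_true]
  exact ⟨x.2, fun _ _ => Finset.empty_subset _⟩

theorem relInterior_subset_carrier : P.relInterior ⊆ P.carrier := sdiff_subset

theorem relInterior_nonempty : P.relInterior.Nonempty := by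
  have h0 : (∅ : Finset (Fin P.numFacets)) ∈ augmentedFaces P.link := Or.inl rfl
  refine ⟨P.chart ⟨barycenterVertex ∅, barycenterVertex_mem_dualCell h0⟩, mem_range_self _, ?_⟩
  simp only [mem_iUnion, not_exists]
  rintro τ hτ ⟨y, hy, hyx⟩
  rw [P.isEmbedding_chart.injective.eq_iff.1 hyx] at hy
  have := (barycenterVertex_mem_dualFace h0).1 hy
  exact (P.link.isRelLowerSet_faces hτ).1.ne_empty (Finset.subset_empty.1 this)

end SimpleCell

/-! ### Incidence of cells in a decomposition -/

namespace SimpleCellDecomposition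

variable {X : Type*} [TopologicalSpace X] (D : SimpleCellDecomposition X)

variable {D} in
theorem Sub.refl (F : D.Cell) : D.Sub F F := Subset.rfl

variable {D} in
theorem Sub.trans {F G H : D.Cell} (h₁ : D.Sub F G) (h₂ : D.Sub G H) : D.Sub F H :=
  Subset.trans h₁ h₂

variable {D} in
theorem Sub.antisymm {F G : D.Cell} (h₁ : D.Sub F G) (h₂ : D.Sub G F) : F = G :=
  D.carrier_injective (Subset.antisymm h₁ h₂)

/-- Injectivity of the chart forces the transition from a cell to itself to be the identity. This
yields piecewise linearity of the identity, and with it compactness of the dual cell, without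
triangulating anything. -/
theorem isPLOn_transition_self (i : D.Cell) :
    ∃ g : (Finset (Fin (D.cell i).numFacets) → ℝ) → (Finset (Fin (D.cell i).numFacets) → ℝ),
      IsPLOn g (dualCell (D.cell i).link) ∧ ∀ x ∈ dualCell (D.cell i).link, g x = x := by
  obtain ⟨g, hg, hPL, h⟩ := D.transition i i Subset.rfl
  refine ⟨g, hPL, fun x hx => ?_⟩
  exact (congrArg Subtype.val ((D.cell i).isEmbedding_chart.injective (h ⟨x, hx⟩))).symm

theorem isClosed_carrier [T2Space X] (i : D.Cell) : IsClosed (D.cell i).carrier := by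
  obtain ⟨g, hPL, -⟩ := D.isPLOn_transition_self i
  have := isCompact_iff_compactSpace.1 hPL.isCompact
  exact (isCompact_range (D.cell i).isEmbedding_chart.continuous).isClosed

theorem exists_face {F G : D.Cell} (h : D.Sub F G) :
    ∃ τ ∈ augmentedFaces (D.cell G).link,
      (D.cell F).carrier = (D.cell G).face τ ∧ D.dim F + τ.card = D.dim G := by
  obtain ⟨τ, hτ, e⟩ := D.eq_face F G h
  obtain ⟨i, hi, hd⟩ := D.face_mem G τ hτ
  obtain rfl : i = F := D.carrier_injective (hi.trans e.symm)
  exact ⟨τ, hτ, e, hd⟩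

theorem dim_le {F G : D.Cell} (h : D.Sub F G) : D.dim F ≤ D.dim G := by
  obtain ⟨τ, -, -, h⟩ := D.exists_face h
  omega

theorem eq_of_sub_of_dim_eq {F G : D.Cell} (h : D.Sub F G) (hd : D.dim F = D.dim G) : F = G := by
  obtain ⟨τ, -, e, h⟩ := D.exists_face h
  obtain rfl : τ = ∅ := Finset.card_eq_zero.1 (by omega)
  exact D.carrier_injective (e.trans (D.cell G).face_empty)

theorem exists_sub_mem_relInterior {x : X} {G : D.Cell} (hx : x ∈ (D.cell G).carrier) :
    ∃ F, D.Sub F G ∧ x ∈ (D.cell F).relInterior := by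
  obtain ⟨k, hk⟩ : ∃ k, D.dim G = k := ⟨_, rfl⟩
  induction k using Nat.strong_induction_on generalizing G with
  | _ k ih =>
    by_cases h : x ∈ (D.cell G).relInterior
    · exact ⟨G, Sub.refl G, h⟩
    · have : x ∈ ⋃ τ ∈ (D.cell G).link, (D.cell G).face τ := by
        by_contra h'
        exact h ⟨hx, h'⟩
      simp only [mem_iUnion] at this
      obtain ⟨τ, hτ, hxτ⟩ := this
      obtain ⟨i, hi, hd⟩ := D.face_mem G τ (Or.inr hτ)
      have hiG : D.Sub i G := by
        rw [Sub, hi]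
        exact (D.cell G).face_subset_carrier τ
      have hpos := Finset.card_pos.2 ((D.cell G).link.isRelLowerSet_faces hτ).1
      obtain ⟨F, hF, hxF⟩ := ih (D.dim i) (by unfold dim at *; omega) (hi ▸ hxτ) rfl
      exact ⟨F, hF.trans hiG, hxF⟩

/-- Any closed cell through `x` has a face with `x` in its relative interior, and that face is `F`
by uniqueness. Incidence at a point thus depends only on the open cell containing it. -/
theorem sub_iff_mem {x : X} {F G : D.Cell} (hx : x ∈ (D.cell F).relInterior) :
    x ∈ (D.cell G).carrier ↔ D.Sub F G := by
  refine ⟨fun h => ?_, fun h => h ((D.cell F).relInterior_subset_carrier hx)⟩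
  obtain ⟨F', hF', hx'⟩ := D.exists_sub_mem_relInterior h
  rwa [(D.existsUnique_mem x).unique hx hx']

/-! ### Facets and codimension-two cells inside an `n`-cell -/

/-- The facets of `G` that contain `F`. -/
def facetsBetween (n : ℕ) (F G : D.Cell) : Set (D.Facet n) := {H | D.Sub F H.1 ∧ D.Sub H.1 G}

instance finite_facet (n : ℕ) : Finite (D.Facet n) :=
  have := D.finite_cell
  inferInstanceAs (Finite {H : D.Cell // D.dim H + 1 = n})

variable {n : ℕ}

theorem facetsBetween_self (H : D.Facet n) {G : D.Cell} (h : D.Sub H.1 G) :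
    D.facetsBetween n H.1 G = {H} := by
  ext H'
  refine ⟨fun h' => Subtype.ext (D.eq_of_sub_of_dim_eq h'.1 ?_).symm, ?_⟩
  · have := H.2
    have := H'.2
    omega
  · rintro rfl
    exact ⟨Sub.refl _, h⟩

theorem exists_vertex {G : D.Cell} (hG : D.dim G = n) {H : D.Facet n} (h : D.Sub H.1 G) :
    ∃ v, (D.cell H.1).carrier = (D.cell G).face {v} ∧ {v} ∈ augmentedFaces (D.cell G).link := by
  obtain ⟨τ, hτ, e, hd⟩ := D.exists_face h
  have := H.2
  obtain ⟨v, rfl⟩ := Finset.card_eq_one.1 (by omega : τ.card = 1)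
  exact ⟨v, e, hτ⟩

/-- If `F` is dual to `τ` in `G`, the facets in question are dual to the vertices of `τ`. -/
theorem ncard_facetsBetween {F G : D.Cell} (hG : D.dim G = n) (h : D.Sub F G) :
    (D.facetsBetween n F G).ncard + D.dim F = n := by
  obtain ⟨τ, hτ, e, hd⟩ := D.exists_face h
  have key : ∀ v, ∃ H : D.Facet n, (D.cell H.1).carrier = (D.cell G).face {v} := by
    intro v
    obtain ⟨i, hi, hdi⟩ := D.face_mem G {v} (Or.inr ((D.cell G).link.singleton_mem v))
    exact ⟨⟨i, by rw [← hG]; simpa [dim] using hdi⟩, hi⟩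
  choose f hf using key
  have himg : D.facetsBetween n F G = f '' (τ : Set (Fin (D.cell G).numFacets)) := by
    ext H
    constructor
    · rintro ⟨h₁, h₂⟩
      obtain ⟨v, hv, -⟩ := D.exists_vertex hG h₂
      have hvτ : v ∈ τ := by
        rw [Sub, hv, e, (D.cell G).face_subset_face_iff hτ] at h₁
        simpa using h₁
      exact ⟨v, hvτ, Subtype.ext (D.carrier_injective ((hf v).trans hv.symm))⟩
    · rintro ⟨v, hv, rfl⟩
      refine ⟨?_, ?_⟩
      · rw [Sub, hf v, e, (D.cell G).face_subset_face_iff hτ]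
        simpa using hv
      · rw [Sub, hf v]
        exact (D.cell G).face_subset_carrier _
  have hinj : InjOn f (τ : Set (Fin (D.cell G).numFacets)) := by
    intro v hv w hw hvw
    have := hf v
    rw [hvw, hf w] at this
    have := ((D.cell G).face_subset_face_iff (mem_augmentedFaces_of_subset hτ
      (Finset.singleton_subset_iff.2 hw))).1 this.le
    simpa using this
  rw [himg, hinj.ncard_image, ncard_coe_finset]
  omega

/-- The two facets are dual to vertices of the simplex dual to `F`; take `E` dual to the edge
spanned by them. -/
theorem exists_codim_two {F G : D.Cell} (hG : D.dim G = n) {H H' : D.Facet n}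
    (hH : H ∈ D.facetsBetween n F G) (hH' : H' ∈ D.facetsBetween n F G) (hne : H' ≠ H) :
    ∃ E, D.dim E + 2 = n ∧ D.Sub F E ∧ D.Sub E H.1 ∧ D.Sub E H'.1 := by
  obtain ⟨τ, hτ, e, hd⟩ := D.exists_face (hH.1.trans hH.2)
  obtain ⟨v, hv, hv'⟩ := D.exists_vertex hG hH.2
  obtain ⟨w, hw, hw'⟩ := D.exists_vertex hG hH'.2
  have hvw : w ≠ v := by
    rintro rfl
    exact hne (Subtype.ext (D.carrier_injective (hw.trans hv.symm)))
  have hvτ : v ∈ τ := by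
    have := hH.1
    rw [Sub, hv, e, (D.cell G).face_subset_face_iff hτ] at this
    simpa using this
  have hwτ : w ∈ τ := by
    have := hH'.1
    rw [Sub, hw, e, (D.cell G).face_subset_face_iff hτ] at this
    simpa using this
  have hsub : ({w, v} : Finset _) ⊆ τ := by
    simp [Finset.insert_subset_iff, hvτ, hwτ]
  have haug := mem_augmentedFaces_of_subset hτ hsub
  obtain ⟨E, hE, hdE⟩ := D.face_mem G _ haug
  refine ⟨E, ?_, ?_, ?_, ?_⟩
  · rw [Finset.card_pair hvw] at hdE
    rw [← hG]
    exact hdE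
  · rw [Sub, hE, e, (D.cell G).face_subset_face_iff hτ]
    exact hsub
  · rw [Sub, hE, hv, (D.cell G).face_subset_face_iff haug]
    simp
  · rw [Sub, hE, hw, (D.cell G).face_subset_face_iff haug]
    simp

/-- Both cells are dual in `G` to the edge spanned by the vertices of the two facets. -/
theorem eq_of_codim_two {E E' G : D.Cell} (hG : D.dim G = n) (hE : D.dim E + 2 = n)
    (hE' : D.dim E' + 2 = n) {H H' : D.Facet n} (hne : H' ≠ H)
    (h₁ : H ∈ D.facetsBetween n E G) (h₂ : H' ∈ D.facetsBetween n E G)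
    (h₁' : H ∈ D.facetsBetween n E' G) (h₂' : H' ∈ D.facetsBetween n E' G) : E = E' := by
  suffices key : ∀ E : D.Cell, D.dim E + 2 = n → H ∈ D.facetsBetween n E G →
      H' ∈ D.facetsBetween n E G → ∀ E' : D.Cell, D.dim E' + 2 = n →
      H ∈ D.facetsBetween n E' G → H' ∈ D.facetsBetween n E' G → D.Sub E E' from
    (key E hE h₁ h₂ E' hE' h₁' h₂').antisymm (key E' hE' h₁' h₂' E hE h₁ h₂)
  intro E hE h₁ h₂ E' hE' h₁' h₂'
  obtain ⟨v, hv, hv'⟩ := D.exists_vertex hG h₁.2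
  obtain ⟨w, hw, hw'⟩ := D.exists_vertex hG h₂.2
  have hvw : w ≠ v := by
    rintro rfl
    exact hne (Subtype.ext (D.carrier_injective (hw.trans hv.symm)))
  have pair : ∀ E : D.Cell, D.dim E + 2 = n → H ∈ D.facetsBetween n E G →
      H' ∈ D.facetsBetween n E G → (D.cell E).carrier = (D.cell G).face {w, v} := by
    intro E hE h₁ h₂
    obtain ⟨τ, hτ, e, hd⟩ := D.exists_face (h₁.1.trans h₁.2)
    have h₁ := h₁.1
    have h₂ := h₂.1
    rw [Sub, hv, e, (D.cell G).face_subset_face_iff hτ] at h₁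
    rw [Sub, hw, e, (D.cell G).face_subset_face_iff hτ] at h₂
    rw [e, Finset.eq_of_subset_of_card_le (Finset.insert_subset_iff.2
      ⟨Finset.singleton_subset_iff.1 h₂, h₁⟩) _]
    rw [Finset.card_pair hvw]
    omega
  rw [Sub, pair E hE h₁ h₂, pair E' hE' h₁' h₂']

end SimpleCellDecomposition

/-! ### Gluing data for a branched cover -/

namespace SimpleCellDecomposition

/-- Combinatorial data describing a branched cover of a decomposed space: finitely many sheets
over every `n`-dimensional cell, glued along the facets, together with labels of the facets of
every sheet that are compatible with the gluing. -/
structure FacetCover {X : Type*} [TopologicalSpace X] (D : SimpleCellDecomposition X)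
    (n : ℕ) where
  Sheet : Type
  finite_sheet : Finite Sheet
  /-- The `n`-dimensional cell below a sheet. -/
  top : Sheet → D.Cell
  dim_top : ∀ t, D.dim (top t) = n
  exists_top : ∀ G, D.dim G = n → ∃ t, top t = G
  /-- Two sheets are glued along the facet `H`. -/
  Rel : D.Facet n → Sheet → Sheet → Prop
  sub_top : ∀ {H t s}, Rel H t s → D.Sub H.1 (top t)
  symm : ∀ {H t s}, Rel H t s → Rel H s t
  trans : ∀ {H t s r}, Rel H t s → Rel H s r → Rel H t r
  -- Together with `eq_of_rel`, this puts the sheets glued to `t` along `H` in bijection with the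
  -- `n`-cells containing `H`: there is no branching in codimension one.
  lift : ∀ {H t G}, D.Sub H.1 (top t) → D.dim G = n → D.Sub H.1 G → ∃ s, top s = G ∧ Rel H t s
  eq_of_rel : ∀ {H t s}, Rel H t s → top t = top s → t = s
  Label : Type
  finite_label : Finite Label
  label : Sheet → D.Facet n → Label
  label_injOn : ∀ t, InjOn (label t) {H | D.Sub H.1 (top t)}
  -- Only sets of labels are matched, not labels of individual facets. For `F = H` the sets are
  -- singletons, so `H` has the same label on both sides.
  image_label_eq : ∀ {H t s F}, Rel H t s → D.Sub F H.1 →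
    label t '' D.facetsBetween n F (top t) = label s '' D.facetsBetween n F (top s)

namespace FacetCover

variable {Z : Type u} [TopologicalSpace Z] {D : SimpleCellDecomposition Z} {n : ℕ}
  (C : D.FacetCover n)

/-! ### Classes of sheets -/

/-- Two sheets are connected by gluings along facets in `A`. -/
def Conn (A : Set (D.Facet n)) : C.Sheet → C.Sheet → Prop :=
  Relation.EqvGen fun t s => ∃ H ∈ A, C.Rel H t s

/-- The class of a sheet under gluings along facets in `A`. -/
def cls (A : Set (D.Facet n)) (t : C.Sheet) : Set C.Sheet := {s | C.Conn A t s}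

variable {C} {A B : Set (D.Facet n)} {t s : C.Sheet}

theorem Conn.refl (t : C.Sheet) : C.Conn A t t := Relation.EqvGen.refl t

theorem Conn.symm (h : C.Conn A t s) : C.Conn A s t := Relation.EqvGen.symm _ _ h

theorem Conn.trans {r : C.Sheet} (h : C.Conn A t s) (h' : C.Conn A s r) : C.Conn A t r :=
  Relation.EqvGen.trans _ _ _ h h'

theorem Conn.mono (hAB : A ⊆ B) (h : C.Conn A t s) : C.Conn B t s :=
  Relation.EqvGen.mono (fun _ _ ⟨H, hH, h⟩ => ⟨H, hAB hH, h⟩) _ _ h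

theorem cls_eq_iff : C.cls A t = C.cls A s ↔ C.Conn A t s := by
  refine ⟨fun h => ?_, fun h => ?_⟩
  · have : s ∈ C.cls A s := Conn.refl s
    rwa [← h] at this
  · ext r
    exact ⟨fun h' => h.symm.trans h', fun h' => h.trans h'⟩

theorem Conn.apply_eq {β : Sort*} (f : C.Sheet → β)
    (hf : ∀ H ∈ A, ∀ t s, C.Rel H t s → f t = f s) (h : C.Conn A t s) : f t = f s := by
  induction h with
  | rel t s h => exact hf _ h.choose_spec.1 _ _ h.choose_spec.2
  | refl => rfl
  | symm _ _ _ ih => exact ih.symm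
  | trans _ _ _ _ _ ih ih' => exact ih.trans ih'

variable (D n) in
/-- The facets containing a point. -/
def facetsAt (x : Z) : Set (D.Facet n) := {H | x ∈ (D.cell H.1).carrier}

variable (D n) in
/-- The facets containing a cell. -/
def facetsOver (F : D.Cell) : Set (D.Facet n) := {H | D.Sub F H.1}

theorem facetsAt_eq_facetsOver {x : Z} {F : D.Cell} (hx : x ∈ (D.cell F).relInterior) :
    facetsAt D n x = facetsOver D n F :=
  Set.ext fun _ => D.sub_iff_mem hx

theorem Conn.sub_top_iff {F : D.Cell} (h : C.Conn (facetsOver D n F) t s) :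
    D.Sub F (C.top t) ↔ D.Sub F (C.top s) := by
  refine iff_of_eq (h.apply_eq (fun t => D.Sub F (C.top t)) fun H hH t s h => ?_)
  exact propext (iff_of_true (Sub.trans hH (C.sub_top h)) (Sub.trans hH (C.sub_top (C.symm h))))

theorem Conn.image_label_eq {F : D.Cell} (h : C.Conn (facetsOver D n F) t s) :
    C.label t '' D.facetsBetween n F (C.top t) = C.label s '' D.facetsBetween n F (C.top s) :=
  h.apply_eq (fun t => C.label t '' D.facetsBetween n F (C.top t))
    fun _ hH _ _ h => C.image_label_eq h hH

theorem Conn.label_eq {H : D.Facet n} (h : C.Conn (facetsOver D n H.1) t s)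
    (ht : D.Sub H.1 (C.top t)) : C.label t H = C.label s H := by
  have := h.image_label_eq
  rw [D.facetsBetween_self H ht, D.facetsBetween_self H (h.sub_top_iff.1 ht)] at this
  simpa using this

/-- `Rel H` is already symmetric and transitive. Equality is a separate case because `Rel H` is
reflexive only on sheets containing `H`. -/
theorem Conn.eq_or_rel {H : D.Facet n} (hA : A ⊆ {H}) (h : C.Conn A t s) :
    t = s ∨ C.Rel H t s := by
  induction h with
  | rel t s h =>
    obtain ⟨H', hH', h⟩ := h
    rw [← hA hH']
    exact Or.inr h
  | refl => exact Or.inl rfl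
  | symm _ _ _ ih => exact ih.imp Eq.symm C.symm
  | trans _ _ _ _ _ ih ih' =>
    rcases ih with rfl | ih
    · exact ih'
    · rcases ih' with rfl | ih'
      · exact Or.inr ih
      · exact Or.inr (C.trans ih ih')

theorem Conn.eq_of_isEmpty (hA : A = ∅) (h : C.Conn A t s) : t = s :=
  h.apply_eq id fun H hH => absurd hH (by simp [hA])

theorem facetsOver_eq_empty {F : D.Cell} (hF : D.dim F = n) : facetsOver D n F = ∅ := by
  refine eq_empty_of_forall_notMem fun H hH => ?_
  have := D.dim_le hH
  have := H.2
  omega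

theorem facetsOver_facet (H : D.Facet n) : facetsOver D n H.1 = {H} := by
  ext H'
  refine ⟨fun h => Subtype.ext (D.eq_of_sub_of_dim_eq h ?_).symm, ?_⟩
  · have := H.2
    have := H'.2
    omega
  · rintro rfl
    exact Sub.refl _

/-! ### The covering space -/

variable (C)

/-- The space obtained by gluing the sheets: a point is a point of `Z` with a class of sheets
containing it. -/
def Space : Type u :=
  {z : Z × Set C.Sheet //
    ∃ t, z.1 ∈ (D.cell (C.top t)).carrier ∧ z.2 = C.cls (facetsAt D n z.1) t}

/-- The inclusion of a sheet. -/
def incl (t : C.Sheet) (x : (D.cell (C.top t)).carrier) : C.Space :=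
  ⟨(x, C.cls (facetsAt D n x) t), t, x.2, rfl⟩

/-- The projection to the decomposed space. -/
def proj (z : C.Space) : Z := z.1.1

instance : TopologicalSpace C.Space :=
  TopologicalSpace.coinduced (fun q : Σ t, (D.cell (C.top t)).carrier => C.incl q.1 q.2)
    inferInstance

theorem isOpen_iff {U : Set C.Space} : IsOpen U ↔ ∀ t, IsOpen (C.incl t ⁻¹' U) := by
  rw [isOpen_coinduced, isOpen_sigma_iff]
  rfl

theorem continuous_incl (t : C.Sheet) : Continuous (C.incl t) :=
  ⟨fun _ hU => C.isOpen_iff.1 hU t⟩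

theorem exists_incl_eq (z : C.Space) : ∃ t x, C.incl t x = z := by
  obtain ⟨⟨x, a⟩, t, hx, ha⟩ := z
  exact ⟨t, ⟨x, hx⟩, Subtype.ext (Prod.ext rfl ha.symm)⟩

theorem continuous_proj : Continuous C.proj :=
  ⟨fun _ hU => C.isOpen_iff.2 fun _ => hU.preimage continuous_subtype_val⟩

theorem isClosedMap_proj [T2Space Z] : IsClosedMap C.proj := by
  intro K hK
  have := C.finite_sheet
  have : C.proj '' K = ⋃ t, Subtype.val '' (C.incl t ⁻¹' K) := by
    ext x
    simp only [mem_image, mem_iUnion, mem_preimage]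
    constructor
    · rintro ⟨z, hz, rfl⟩
      obtain ⟨t, x, rfl⟩ := C.exists_incl_eq z
      exact ⟨t, x, hz, rfl⟩
    · rintro ⟨t, x, hx, rfl⟩
      exact ⟨_, hx, rfl⟩
  rw [this]
  exact isClosed_iUnion_of_finite fun t =>
    (D.isClosed_carrier _).isClosedEmbedding_subtypeVal.isClosedMap _
      (hK.preimage (C.continuous_incl t))

theorem surjective_proj (hD : D.IsPseudoManifold n) : Function.Surjective C.proj := by
  intro x
  obtain ⟨F, hF, -⟩ := D.existsUnique_mem x
  obtain ⟨G, hG, hFG⟩ := hD.exists_top F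
  obtain ⟨t, rfl⟩ := C.exists_top G hG
  exact ⟨C.incl t ⟨x, hFG ((D.cell F).relInterior_subset_carrier hF)⟩, rfl⟩

/-! ### Open stars and the Hausdorff property -/

variable (D) in
/-- The open star of a point: the complement of the cells that do not contain it. -/
def star (x : Z) : Set Z := {y | ∀ F : D.Cell, y ∈ (D.cell F).carrier → x ∈ (D.cell F).carrier}

theorem mem_star_self (x : Z) : x ∈ star D x := fun _ h => h

theorem isOpen_star [T2Space Z] (x : Z) : IsOpen (star D x) := by
  have := D.finite_cell
  have : star D x = ⋂ F : {F : D.Cell // x ∉ (D.cell F).carrier}, (D.cell F.1).carrierᶜ := by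
    ext y
    simp only [star, mem_ofPred_eq, mem_iInter, mem_compl_iff, Subtype.forall]
    exact forall_congr' fun F => by tauto
  rw [this]
  exact isOpen_iInter_of_finite fun F => (D.isClosed_carrier _).isOpen_compl

theorem facetsAt_subset_of_mem_star {x y : Z} (h : y ∈ star D x) :
    facetsAt D n y ⊆ facetsAt D n x := fun H hH => h H.1 hH

/-- The class of sheets at `x` to which a point over the open star of `x` belongs. -/
def localClass (x : Z) (z : C.Space) : Set C.Sheet :=
  {s | ∃ t ∈ z.1.2, C.Conn (facetsAt D n x) t s}

variable {C} in
theorem localClass_incl {x : Z} {y : (D.cell (C.top t)).carrier} (h : (y : Z) ∈ star D x) :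
    C.localClass x (C.incl t y) = C.cls (facetsAt D n x) t := by
  ext s
  constructor
  · rintro ⟨r, hr, hrs⟩
    exact (Conn.mono (facetsAt_subset_of_mem_star h) hr).trans hrs
  · exact fun hs => ⟨t, Conn.refl t, hs⟩

theorem localClass_self (z : C.Space) : C.localClass (C.proj z) z = z.1.2 := by
  obtain ⟨t, x, rfl⟩ := C.exists_incl_eq z
  exact localClass_incl (mem_star_self _)

/-- Within one sheet the local class is constant over the star, so the preimage is either the whole
star or empty. These sets separate points of one fibre and give the local trivialization. -/
theorem isOpen_localClass_eq [T2Space Z] (x : Z) (b : Set C.Sheet) :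
    IsOpen {z | C.proj z ∈ star D x ∧ C.localClass x z = b} := by
  refine C.isOpen_iff.2 fun t => ?_
  have hopen : IsOpen ((↑) ⁻¹' star D x : Set (D.cell (C.top t)).carrier) :=
    (isOpen_star x).preimage continuous_subtype_val
  by_cases hb : C.cls (facetsAt D n x) t = b
  · convert hopen using 1
    ext y
    refine ⟨fun h => h.1, fun h => ⟨h, ?_⟩⟩
    rw [localClass_incl h, hb]
  · convert isOpen_empty using 1
    refine eq_empty_of_forall_notMem fun y h => hb ?_
    rw [← localClass_incl h.1]
    exact h.2

instance [T2Space Z] : T2Space C.Space := by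
  refine ⟨fun z w hzw => ?_⟩
  by_cases h : C.proj z = C.proj w
  · refine ⟨_, _, C.isOpen_localClass_eq (C.proj z) z.1.2, C.isOpen_localClass_eq (C.proj z) w.1.2,
      ⟨mem_star_self _, C.localClass_self z⟩, ⟨?_, ?_⟩, ?_⟩
    · rw [h]
      exact mem_star_self _
    · rw [h]
      exact C.localClass_self w
    · rw [Set.disjoint_left]
      rintro v ⟨-, h₁⟩ ⟨-, h₂⟩
      exact hzw (Subtype.ext (Prod.ext h (h₁.symm.trans h₂)))
  · obtain ⟨U, V, hU, hV, hzU, hwV, hUV⟩ := t2_separation h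
    exact ⟨_, _, hU.preimage C.continuous_proj, hV.preimage C.continuous_proj, hzU, hwV,
      hUV.preimage _⟩

end FacetCover

end SimpleCellDecomposition

theorem IsClosedMap.prodMk_of_discrete {X Y I : Type*} [TopologicalSpace X] [TopologicalSpace Y]
    [TopologicalSpace I] [DiscreteTopology I] [Finite I] {f : X → Y} {g : X → I}
    (hf : IsClosedMap f) (hg : Continuous g) : IsClosedMap fun x => (f x, g x) := by
  intro K hK
  have : (fun x => (f x, g x)) '' K = ⋃ i, (f '' (K ∩ g ⁻¹' {i})) ×ˢ {i} := by
    ext ⟨y, i⟩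
    simp only [mem_image, Prod.mk.injEq, mem_iUnion, mem_prod, mem_inter_iff, mem_preimage,
      mem_singleton_iff]
    constructor
    · rintro ⟨x, hx, rfl, rfl⟩
      exact ⟨_, ⟨x, ⟨hx, rfl⟩, rfl⟩, rfl⟩
    · rintro ⟨_, ⟨x, ⟨hx, rfl⟩, rfl⟩, rfl⟩
      exact ⟨x, hx, rfl, rfl⟩
  rw [this]
  exact isClosed_iUnion_of_finite fun i =>
    (hf _ (hK.inter ((isClosed_discrete _).preimage hg))).prod (isClosed_discrete _)

namespace SimpleCellDecomposition

namespace FacetCover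

variable {Z : Type u} [TopologicalSpace Z] {D : SimpleCellDecomposition Z} {n : ℕ}
  (C : D.FacetCover n)

/-! ### The projection is a covering away from codimension two -/

theorem le_dim_add_one_of_notMem_skeleton {x : Z} (hx : x ∉ D.codimTwoSkeleton n) {F : D.Cell}
    (hF : x ∈ (D.cell F).carrier) : n ≤ D.dim F + 1 := by
  by_contra h
  refine hx ?_
  simp only [codimTwoSkeleton, mem_iUnion]
  exact ⟨F, by omega, hF⟩

variable {C}

/-- Injectivity of the trivialization. At most one facet `H` passes through `x`. A nearby `y` either
lies in the open facet, where the same gluing applies, or inside an `n`-cell, where both sheets lie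
over that cell and `eq_of_rel` identifies them. -/
theorem Conn.of_mem_star (hD : D.IsPseudoManifold n) {x y : Z} (hx : x ∉ D.codimTwoSkeleton n)
    (hy : y ∈ star D x) {t s : C.Sheet} (ht : y ∈ (D.cell (C.top t)).carrier)
    (hs : y ∈ (D.cell (C.top s)).carrier) (h : C.Conn (facetsAt D n x) t s) :
    C.Conn (facetsAt D n y) t s := by
  obtain ⟨F, hF, -⟩ := D.existsUnique_mem x
  obtain ⟨F', hF', -⟩ := D.existsUnique_mem y
  have hFF' : D.Sub F F' :=
    (D.sub_iff_mem hF).1 (hy F' ((D.cell F').relInterior_subset_carrier hF'))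
  have dim_le_n : ∀ F, D.dim F ≤ n := fun F => by
    obtain ⟨G, hG, hFG⟩ := hD.exists_top F
    exact hG ▸ D.dim_le hFG
  have hdF := le_dim_add_one_of_notMem_skeleton hx ((D.cell F).relInterior_subset_carrier hF)
  rw [facetsAt_eq_facetsOver hF] at h
  rcases (dim_le_n F).eq_or_lt with hn | hn
  · rw [h.eq_of_isEmpty (facetsOver_eq_empty hn)]
    exact Conn.refl _
  let H : D.Facet n := ⟨F, by omega⟩
  rcases h.eq_or_rel (facetsOver_facet H).le with rfl | h
  · exact Conn.refl _
  rw [D.sub_iff_mem hF'] at ht hs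
  rw [facetsAt_eq_facetsOver hF']
  have hdF' := D.dim_le hFF'
  rcases (dim_le_n F').eq_or_lt with hn' | hn'
  · rw [C.eq_of_rel h ((D.eq_of_sub_of_dim_eq ht (hn'.trans (C.dim_top t).symm)).symm.trans
      (D.eq_of_sub_of_dim_eq hs (hn'.trans (C.dim_top s).symm)))]
    exact Conn.refl _
  · obtain rfl := D.eq_of_sub_of_dim_eq hFF' (by omega)
    exact Relation.EqvGen.rel _ _ ⟨H, Sub.refl F, h⟩

/-- Surjectivity of the trivialization: if `x` is in an open facet, the sheet `s` is continued
across it to the cell containing `y`. -/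
theorem exists_conn_of_mem_star (hD : D.IsPseudoManifold n) {x y : Z}
    (hx : x ∉ D.codimTwoSkeleton n) (hy : y ∈ star D x) {s : C.Sheet}
    (hs : x ∈ (D.cell (C.top s)).carrier) :
    ∃ t, y ∈ (D.cell (C.top t)).carrier ∧ C.Conn (facetsAt D n x) s t := by
  obtain ⟨F, hF, -⟩ := D.existsUnique_mem x
  obtain ⟨F', hF', -⟩ := D.existsUnique_mem y
  obtain ⟨G, hG, hF'G⟩ := hD.exists_top F'
  have hyG := hF'G ((D.cell F').relInterior_subset_carrier hF')
  have hFG := (D.sub_iff_mem hF).1 (hy G hyG)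
  have hdF := le_dim_add_one_of_notMem_skeleton hx ((D.cell F).relInterior_subset_carrier hF)
  rw [D.sub_iff_mem hF] at hs
  have hdG := D.dim_le hFG
  rcases (hG ▸ D.dim_le hFG : D.dim F ≤ n).eq_or_lt with hn | hn
  · obtain rfl := D.eq_of_sub_of_dim_eq hFG (hn.trans hG.symm)
    rw [D.eq_of_sub_of_dim_eq hs (hn.trans (C.dim_top s).symm)] at hyG
    exact ⟨s, hyG, Conn.refl s⟩
  · let H : D.Facet n := ⟨F, by omega⟩
    obtain ⟨t, rfl, ht⟩ := C.lift (H := H) hs hG hFG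
    refine ⟨t, hyG, Relation.EqvGen.rel _ _ ⟨H, ?_, ht⟩⟩
    exact (D.cell F).relInterior_subset_carrier hF

variable (C)

theorem isCoveringMapOn_proj [T2Space Z] (hD : D.IsPseudoManifold n) :
    IsCoveringMapOn C.proj (D.codimTwoSkeleton n)ᶜ := by
  intro x hx
  have := C.finite_sheet
  -- The classes of sheets at `x`, that is, the fibre over `x`.
  let I : Type := {a : Set C.Sheet //
    ∃ t, x ∈ (D.cell (C.top t)).carrier ∧ a = C.cls (facetsAt D n x) t}
  let _ : TopologicalSpace I := ⊥
  have : DiscreteTopology I := ⟨rfl⟩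
  let f : C.proj ⁻¹' star D x → I := fun z => ⟨C.localClass x z, by
    obtain ⟨z, hz⟩ := z
    obtain ⟨t, y, rfl⟩ := C.exists_incl_eq z
    exact ⟨t, hz _ y.2, localClass_incl hz⟩⟩
  have hf : Continuous f := by
    refine continuous_discrete_rng.2 fun b => ?_
    convert (C.isOpen_localClass_eq x b.1).preimage continuous_subtype_val using 1
    ext z
    exact ⟨fun h => ⟨z.2, congrArg Subtype.val h⟩, fun h => Subtype.ext h.2⟩
  let Φ : C.proj ⁻¹' star D x → star D x × I := fun z => ((star D x).restrictPreimage C.proj z, f z)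
  have hΦ : Continuous Φ := C.continuous_proj.restrictPreimage.prodMk hf
  have hΦc : IsClosedMap Φ := (C.isClosedMap_proj.restrictPreimage _).prodMk_of_discrete hf
  have hΦb : Function.Bijective Φ := by
    constructor
    · rintro ⟨z, hz⟩ ⟨w, hw⟩ h
      obtain ⟨t, y, rfl⟩ := C.exists_incl_eq z
      obtain ⟨s, y', rfl⟩ := C.exists_incl_eq w
      have hy : (y : Z) = y' := congrArg (fun q => (q.1 : Z)) h
      have hc : C.localClass x (C.incl t y) = C.localClass x (C.incl s y') :=
        congrArg (fun q => (q.2 : Set C.Sheet)) h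
      rw [localClass_incl hz, localClass_incl hw, cls_eq_iff] at hc
      refine Subtype.ext (Subtype.ext (Prod.ext hy ?_))
      change C.cls (facetsAt D n (y : Z)) t = C.cls (facetsAt D n (y' : Z)) s
      rw [← hy, cls_eq_iff]
      exact hc.of_mem_star hD hx hz y.2 (hy.symm ▸ y'.2 : (y : Z) ∈ _)
    · rintro ⟨⟨y, hy⟩, ⟨a, s, hs, rfl⟩⟩
      obtain ⟨t, ht, hst⟩ := exists_conn_of_mem_star hD hx hy hs
      refine ⟨⟨C.incl t ⟨y, ht⟩, hy⟩, Prod.ext rfl (Subtype.ext ?_)⟩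
      exact (localClass_incl hy).trans (cls_eq_iff.2 hst.symm)
  have key : IsEvenlyCovered C.proj x I :=
    ⟨inferInstance, star D x, mem_star_self x, isOpen_star x,
      (isOpen_star x).preimage C.continuous_proj,
      (Equiv.ofBijective Φ hΦb).toHomeomorphOfContinuousClosed hΦ hΦc, fun _ => rfl⟩
  exact key.to_isEvenlyCovered_preimage

/-! ### The decomposition of the covering space -/

/-- The cells of the covering space: a cell of `D` with a class of sheets containing it. -/
def CoverCell : Type :=
  {c : D.Cell × Set C.Sheet // ∃ t, D.Sub c.1 (C.top t) ∧ c.2 = C.cls (facetsOver D n c.1) t}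

variable {C}

/-- The cell of `D` below a cell of the covering space. -/
def CoverCell.base (c : C.CoverCell) : D.Cell := c.1.1

/-- A sheet containing a cell of the covering space. -/
noncomputable def CoverCell.rep (c : C.CoverCell) : C.Sheet := c.2.choose

theorem CoverCell.sub_rep (c : C.CoverCell) : D.Sub c.base (C.top c.rep) := c.2.choose_spec.1

theorem CoverCell.snd_eq (c : C.CoverCell) : c.1.2 = C.cls (facetsOver D n c.base) c.rep :=
  c.2.choose_spec.2

theorem CoverCell.ext {c c' : C.CoverCell} (h : c.base = c'.base)
    (h' : C.Conn (facetsOver D n c.base) c.rep c'.rep) : c = c' := by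
  refine Subtype.ext (Prod.ext h ?_)
  rw [c.snd_eq, c'.snd_eq, ← h, cls_eq_iff]
  exact h'

/-- The cell over `F` in the sheet `t`. -/
def cellIn (F : D.Cell) (t : C.Sheet) (h : D.Sub F (C.top t)) : C.CoverCell :=
  ⟨(F, C.cls (facetsOver D n F) t), t, h, rfl⟩

theorem conn_rep_cellIn {F : D.Cell} {t : C.Sheet} (h : D.Sub F (C.top t)) :
    C.Conn (facetsOver D n F) (cellIn F t h).rep t :=
  (cls_eq_iff.1 (cellIn F t h).snd_eq).symm

/-- A cell of the covering space as a simple cell, with the chart of the cell below it. -/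
noncomputable def CoverCell.simpleCell (c : C.CoverCell) : SimpleCell C.Space where
  dim := (D.cell c.base).dim
  numFacets := (D.cell c.base).numFacets
  link := (D.cell c.base).link
  isPLSphere_link := (D.cell c.base).isPLSphere_link
  chart x := C.incl c.rep ⟨(D.cell c.base).chart x, c.sub_rep (mem_range_self x)⟩
  isEmbedding_chart := by
    refine Topology.IsEmbedding.of_comp ?_ C.continuous_proj (D.cell c.base).isEmbedding_chart
    exact (C.continuous_incl _).comp ((D.cell c.base).isEmbedding_chart.continuous.subtype_mk _)

theorem CoverCell.mem_face {c : C.CoverCell} {τ : Finset (Fin (D.cell c.base).numFacets)}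
    {z : C.Space} : z ∈ c.simpleCell.face τ ↔
      C.proj z ∈ (D.cell c.base).face τ ∧ z.1.2 = C.cls (facetsAt D n (C.proj z)) c.rep := by
  constructor
  · rintro ⟨x, hx, rfl⟩
    exact ⟨⟨x, hx, rfl⟩, rfl⟩
  · rintro ⟨⟨x, hx, hxz⟩, h⟩
    refine ⟨x, hx, Subtype.ext (Prod.ext hxz ?_)⟩
    rw [h, ← hxz]
    rfl

theorem CoverCell.mem_carrier {c : C.CoverCell} {z : C.Space} :
    z ∈ c.simpleCell.carrier ↔
      C.proj z ∈ (D.cell c.base).carrier ∧ z.1.2 = C.cls (facetsAt D n (C.proj z)) c.rep := by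
  rw [← SimpleCell.face_empty, ← SimpleCell.face_empty]
  exact mem_face

theorem CoverCell.mem_relInterior {c : C.CoverCell} {z : C.Space} :
    z ∈ c.simpleCell.relInterior ↔
      C.proj z ∈ (D.cell c.base).relInterior ∧ z.1.2 = c.1.2 := by
  have key : z ∈ c.simpleCell.relInterior ↔ C.proj z ∈ (D.cell c.base).relInterior ∧
      z.1.2 = C.cls (facetsAt D n (C.proj z)) c.rep := by
    have hf : ∀ τ, z ∈ c.simpleCell.face τ ↔ _ := fun τ => mem_face
    rw [SimpleCell.relInterior, SimpleCell.relInterior, mem_sdiff, mem_sdiff, mem_carrier]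
    simp only [mem_iUnion, not_exists, hf]
    constructor
    · rintro ⟨⟨h₁, h₂⟩, h₃⟩
      exact ⟨⟨h₁, fun τ hτ h => h₃ τ hτ ⟨h, h₂⟩⟩, h₂⟩
    · rintro ⟨⟨h₁, h₃⟩, h₂⟩
      exact ⟨⟨h₁, h₂⟩, fun τ hτ h => h₃ τ hτ h.1⟩
  rw [key]
  refine and_congr_right fun h => ?_
  rw [facetsAt_eq_facetsOver h, c.snd_eq]

/-- Test at a point over the relative interior of the base of `c`: the facets through it are exactly
those containing that base. At other points there are only more gluings. -/
theorem CoverCell.carrier_subset_iff {c c' : C.CoverCell} :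
    c.simpleCell.carrier ⊆ c'.simpleCell.carrier ↔
      D.Sub c.base c'.base ∧ C.Conn (facetsOver D n c.base) c.rep c'.rep := by
  constructor
  · intro h
    obtain ⟨x, hx⟩ := (D.cell c.base).relInterior_nonempty
    have hxc := (D.cell c.base).relInterior_subset_carrier hx
    have := mem_carrier.1 (@h (C.incl c.rep ⟨x, c.sub_rep hxc⟩) (mem_carrier.2 ⟨hxc, rfl⟩))
    refine ⟨(D.sub_iff_mem hx).1 this.1, ?_⟩
    rw [← facetsAt_eq_facetsOver hx, ← cls_eq_iff]
    exact this.2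
  · rintro ⟨h, h'⟩ z hz
    rw [mem_carrier] at hz ⊢
    refine ⟨h hz.1, hz.2.trans (cls_eq_iff.2 (h'.mono fun H hH => ?_))⟩
    exact hH hz.1

theorem CoverCell.simpleCell_carrier_injective :
    Function.Injective fun c : C.CoverCell => c.simpleCell.carrier := by
  intro c c' h
  have h₁ := carrier_subset_iff.1 h.le
  have h₂ := carrier_subset_iff.1 h.ge
  exact CoverCell.ext (h₁.1.antisymm h₂.1) h₁.2

theorem CoverCell.carrier_eq_face {c c' : C.CoverCell}
    (h : c.simpleCell.carrier ⊆ c'.simpleCell.carrier)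
    {τ : Finset (Fin (D.cell c'.base).numFacets)}
    (hτ : (D.cell c.base).carrier = (D.cell c'.base).face τ) :
    c.simpleCell.carrier = c'.simpleCell.face τ := by
  ext z
  rw [mem_carrier, mem_face, hτ]
  refine and_congr_right fun hz => ?_
  rw [cls_eq_iff.2 ((carrier_subset_iff.1 h).2.mono fun H hH => ?_)]
  rw [← hτ] at hz
  exact hH hz

variable (C)

/-- The decomposition of the covering space. -/
noncomputable def decomposition : SimpleCellDecomposition C.Space where
  Cell := C.CoverCell
  finite_cell := by
    have := D.finite_cell
    have := C.finite_sheet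
    exact inferInstanceAs (Finite {c : D.Cell × Set C.Sheet // _})
  cell := CoverCell.simpleCell
  carrier_injective := CoverCell.simpleCell_carrier_injective
  face_mem := by
    intro c τ hτ
    obtain ⟨i, hi, hd⟩ := D.face_mem c.base τ hτ
    have hic : D.Sub i c.base := by
      rw [Sub, hi]
      exact SimpleCell.face_subset_carrier _ _
    refine ⟨cellIn i c.rep (hic.trans c.sub_rep), CoverCell.carrier_eq_face ?_ hi, hd⟩
    exact CoverCell.carrier_subset_iff.2 ⟨hic, conn_rep_cellIn _⟩
  eq_face := by
    intro c c' h
    obtain ⟨τ, hτ, e⟩ := D.eq_face c.base c'.base (CoverCell.carrier_subset_iff.1 h).1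
    exact ⟨τ, hτ, CoverCell.carrier_eq_face h e⟩
  existsUnique_mem := by
    intro z
    obtain ⟨F, hF, huniq⟩ := D.existsUnique_mem (C.proj z)
    obtain ⟨t, y, rfl⟩ := C.exists_incl_eq z
    refine ⟨cellIn F t ((D.sub_iff_mem hF).1 y.2), CoverCell.mem_relInterior.2 ⟨hF, ?_⟩, ?_⟩
    · exact congrArg (fun A => C.cls A t) (facetsAt_eq_facetsOver hF)
    · intro c hc
      obtain ⟨h₁, h₂⟩ := CoverCell.mem_relInterior.1 hc
      refine Subtype.ext (Prod.ext (huniq _ h₁) ?_)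
      rw [← h₂]
      exact congrArg (fun A => C.cls A t) (facetsAt_eq_facetsOver hF)
  transition := by
    intro c c' h
    obtain ⟨h₁, h₂⟩ := CoverCell.carrier_subset_iff.1 h
    obtain ⟨g, hg, hPL, hgx⟩ := D.transition c.base c'.base h₁
    refine ⟨g, hg, hPL, fun x => Subtype.ext (Prod.ext (hgx x) ?_)⟩
    change C.cls (facetsAt D n ((D.cell c.base).chart x)) c.rep =
      C.cls (facetsAt D n ((D.cell c'.base).chart ⟨g x.1, hg x.2⟩)) c'.rep
    rw [← hgx x, cls_eq_iff]
    refine h₂.mono fun H (hH : D.Sub c.base H.1) => ?_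
    exact hH (mem_range_self x)

theorem decomposition_sub_iff {c c' : C.CoverCell} : C.decomposition.Sub c c' ↔
    D.Sub c.base c'.base ∧ C.Conn (facetsOver D n c.base) c.rep c'.rep :=
  CoverCell.carrier_subset_iff

theorem mapsIso_proj (c : C.CoverCell) :
    SimpleCell.MapsIso C.proj (C.decomposition.cell c) (D.cell c.base) := by
  obtain ⟨g, hPL, hg⟩ := D.isPLOn_transition_self c.base
  refine ⟨⟨g, (bijOn_id _).congr fun x hx => (hg x hx).symm, hPL, fun x => ?_⟩, ?_⟩
  · exact congrArg (D.cell c.base).chart (Subtype.ext (hg x.1 x.2).symm)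
  · have : ∀ τ, C.proj '' (C.decomposition.cell c).face τ = (D.cell c.base).face τ := by
      intro τ
      ext x
      constructor
      · rintro ⟨z, hz, rfl⟩
        exact (CoverCell.mem_face.1 hz).1
      · intro hx
        exact ⟨C.incl c.rep ⟨x, c.sub_rep (SimpleCell.face_subset_carrier _ _ hx)⟩,
          CoverCell.mem_face.2 ⟨hx, rfl⟩, rfl⟩
    simp only [this]
    rfl

/-! ### The pseudo-manifold property and the labeling -/

/-- The cell of the covering space given by a sheet. -/
def sheetCell (t : C.Sheet) : C.CoverCell := cellIn (C.top t) t (Sub.refl _)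

theorem rep_sheetCell (t : C.Sheet) : (C.sheetCell t).rep = t :=
  (conn_rep_cellIn (Sub.refl (C.top t))).eq_of_isEmpty (facetsOver_eq_empty (C.dim_top t))

theorem eq_sheetCell {c : C.CoverCell} (hc : D.dim c.base = n) : c = C.sheetCell c.rep := by
  refine CoverCell.ext (D.eq_of_sub_of_dim_eq c.sub_rep (hc.trans (C.dim_top _).symm)) ?_
  rw [rep_sheetCell]
  exact Conn.refl _

theorem sub_sheetCell_iff {c : C.CoverCell} {t : C.Sheet} :
    C.decomposition.Sub c (C.sheetCell t) ↔ C.Conn (facetsOver D n c.base) c.rep t := by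
  rw [decomposition_sub_iff, rep_sheetCell]
  exact ⟨fun h => h.2, fun h => ⟨h.sub_top_iff.1 c.sub_rep, h⟩⟩

theorem sheetCell_injective : Function.Injective C.sheetCell := fun t s h => by
  rw [← C.rep_sheetCell t, h, rep_sheetCell]

theorem rel_refl {H : D.Facet n} {t : C.Sheet} (h : D.Sub H.1 (C.top t)) : C.Rel H t t := by
  obtain ⟨s, -, hs⟩ := C.lift h (C.dim_top t) h
  exact C.trans hs (C.symm hs)

theorem conn_facet_iff {H : D.Facet n} {t s : C.Sheet} (ht : D.Sub H.1 (C.top t)) :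
    C.Conn (facetsOver D n H.1) t s ↔ C.Rel H t s := by
  refine ⟨fun h => ?_, fun h => Relation.EqvGen.rel _ _ ⟨H, Sub.refl _, h⟩⟩
  rcases h.eq_or_rel (facetsOver_facet H).le with rfl | h
  exacts [C.rel_refl ht, h]

theorem isPseudoManifold_decomposition (hD : D.IsPseudoManifold n) :
    C.decomposition.IsPseudoManifold n where
  exists_top c := ⟨C.sheetCell c.rep, C.dim_top _, C.sub_sheetCell_iff.2 (Conn.refl _)⟩
  ncard_top c hc := by
    let H : D.Facet n := ⟨c.base, hc⟩
    have hH : D.Sub H.1 (C.top c.rep) := c.sub_rep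
    have hset : {c' | C.decomposition.dim c' = n ∧ C.decomposition.Sub c c'} =
        C.sheetCell '' {t | C.Rel H c.rep t} := by
      ext c'
      constructor
      · rintro ⟨h₁, h₂⟩
        have := C.eq_sheetCell h₁
        refine ⟨c'.rep, ?_, this.symm⟩
        rw [this] at h₂
        exact (C.conn_facet_iff hH).1 (C.sub_sheetCell_iff.1 h₂)
      · rintro ⟨t, ht, rfl⟩
        exact ⟨C.dim_top t, C.sub_sheetCell_iff.2 ((C.conn_facet_iff hH).2 ht)⟩
    have htop : {G | D.dim G = n ∧ D.Sub c.base G} = C.top '' {t | C.Rel H c.rep t} := by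
      ext G
      constructor
      · rintro ⟨h₁, h₂⟩
        obtain ⟨t, ht, h⟩ := C.lift hH h₁ h₂
        exact ⟨t, h, ht⟩
      · rintro ⟨t, ht, rfl⟩
        exact ⟨C.dim_top t, C.sub_top (C.symm ht)⟩
    have hinj : InjOn C.top {t | C.Rel H c.rep t} := fun t ht s hs h =>
      C.eq_of_rel (C.trans (C.symm ht) hs) h
    rw [hset]
    refine (ncard_image_of_injective _ C.sheetCell_injective).trans ?_
    rw [← hinj.ncard_image, ← htop]
    exact hD.ncard_top _ hc

/-- The facet of `D` below a facet of the covering space. -/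
def baseFacet (H : C.decomposition.Facet n) : D.Facet n := ⟨CoverCell.base H.1, H.2⟩

/-- The labeling of the facets of the covering space. -/
noncomputable def facetLabel (H : C.decomposition.Facet n) : C.Label :=
  C.label (CoverCell.rep H.1) (C.baseFacet H)

theorem facetLabel_eq {H : C.decomposition.Facet n} {t : C.Sheet}
    (h : C.decomposition.Sub H.1 (C.sheetCell t)) : C.facetLabel H = C.label t (C.baseFacet H) :=
  (C.sub_sheetCell_iff.1 h).label_eq (H := C.baseFacet H) (CoverCell.sub_rep H.1)

/-- A facet over `c` may lie in sheets other than `c.rep`, but these are glued to `c.rep` around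
`c`, so they contribute no new labels. -/
theorem labelSet_eq (c : C.CoverCell) : labelSet C.facetLabel c =
    C.label c.rep '' D.facetsBetween n c.base (C.top c.rep) := by
  ext a
  constructor
  · rintro ⟨H, hH, rfl⟩
    obtain ⟨h₁, h₂⟩ := C.decomposition_sub_iff.1 hH
    rw [h₂.image_label_eq]
    exact ⟨C.baseFacet H, ⟨h₁, CoverCell.sub_rep H.1⟩, rfl⟩
  · rintro ⟨H, ⟨h₁, h₂⟩, rfl⟩
    refine ⟨⟨cellIn H.1 c.rep h₂, H.2⟩, ?_, ?_⟩
    · exact C.decomposition_sub_iff.2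
        ⟨h₁, (conn_rep_cellIn h₂).symm.mono fun H' h => h₁.trans h⟩
    · exact C.facetLabel_eq (C.sub_sheetCell_iff.2 (conn_rep_cellIn h₂))

theorem isGoodLabeling_facetLabel : IsGoodLabeling C.facetLabel := by
  constructor
  · intro c
    have hinj := (C.label_injOn (CoverCell.rep c)).mono
      (fun H (h : H ∈ D.facetsBetween n (CoverCell.base c) _) => h.2)
    have hcard := D.ncard_facetsBetween (C.dim_top _) (CoverCell.sub_rep c)
    rw [← hinj.ncard_image, ← C.labelSet_eq c] at hcard
    exact hcard
  · intro c c' hc' h H hH H' hH' e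
    rw [C.eq_sheetCell (c := c') hc'] at hH hH'
    rw [C.facetLabel_eq hH.2, C.facetLabel_eq hH'.2] at e
    have h₁ := C.sub_sheetCell_iff.1 hH.2
    have h₂ := C.sub_sheetCell_iff.1 hH'.2
    have e' := C.label_injOn _ (h₁.sub_top_iff.1 (CoverCell.sub_rep H.1))
      (h₂.sub_top_iff.1 (CoverCell.sub_rep H'.1)) e
    have e'' : CoverCell.base H.1 = CoverCell.base H'.1 := congrArg Subtype.val e'
    refine Subtype.ext (CoverCell.ext e'' (h₁.trans ?_))
    rw [e'']
    exact h₂.symm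

theorem isStronglyConnected_decomposition
    (h : ∀ t s, Relation.ReflTransGen (fun t s => ∃ H, C.Rel H t s) t s) :
    C.decomposition.IsStronglyConnected n := by
  intro c c' hc hc'
  rw [C.eq_sheetCell hc, C.eq_sheetCell hc']
  refine (h (CoverCell.rep c) (CoverCell.rep c')).lift C.sheetCell ?_
  rintro t s ⟨H, hts⟩
  refine ⟨C.dim_top t, C.dim_top s, cellIn H.1 t (C.sub_top hts), H.2, ?_, ?_⟩
  · exact C.sub_sheetCell_iff.2 (conn_rep_cellIn _)
  · exact C.sub_sheetCell_iff.2 ((conn_rep_cellIn _).trans ((C.conn_facet_iff (C.sub_top hts)).2 hts))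

end FacetCover

end SimpleCellDecomposition

/-- Lets a matching between facets of two `n`-cells be extended to a permutation of all facets, so
that it can be composed with labelings. -/
theorem exists_perm_apply_eq {ι X : Type*} [Finite X] {e e' : ι → X} (he : Function.Injective e)
    (he' : Function.Injective e') : ∃ ψ : Equiv.Perm X, ∀ i, ψ (e i) = e' i := by
  classical
  have := Fintype.ofFinite X
  let f : {x // x ∈ range e} ≃ {x // x ∈ range e'} :=
    (Equiv.ofInjective e he).symm.trans (Equiv.ofInjective e' he')
  refine ⟨f.extendSubtype, fun i => ?_⟩
  rw [f.extendSubtype_apply_of_mem (e i) (mem_range_self i)]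
  have : (Equiv.ofInjective e he).symm ⟨e i, mem_range_self i⟩ = i :=
    (Equiv.symm_apply_eq _).2 rfl
  simp [f, this]

namespace SimpleCellDecomposition

/-! ### Existence of facet covers -/

section

variable {X : Type*} [TopologicalSpace X] (D : SimpleCellDecomposition X) {n : ℕ}

/-- The facets of `G` meeting the facet `H` in codimension two are indexed, uniformly in `G`, by
the cells of codimension two in `H`. -/
theorem exists_facets_param (H : D.Facet n) {G : D.Cell} (hG : D.dim G = n) (hHG : D.Sub H.1 G) :
    ∃ e : Option {E : D.Cell // D.dim E + 2 = n ∧ D.Sub E H.1} → D.Facet n,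
      Function.Injective e ∧ ∀ F, D.Sub F H.1 →
        e '' {o | ∀ E ∈ o, D.Sub F E.1} = D.facetsBetween n F G := by
  have hcard : ∀ E : {E : D.Cell // D.dim E + 2 = n ∧ D.Sub E H.1},
      (D.facetsBetween n E.1 G).ncard = 2 := fun E => by
    have := D.ncard_facetsBetween hG (E.2.2.trans hHG)
    have := E.2.1
    omega
  have hother : ∀ E : {E : D.Cell // D.dim E + 2 = n ∧ D.Sub E H.1},
      ∃ H' ∈ D.facetsBetween n E.1 G, H' ≠ H := fun E =>
    exists_ne_of_one_lt_ncard (by rw [hcard E]; norm_num) H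
  choose f hf hfne using hother
  have hmem : ∀ E : {E : D.Cell // D.dim E + 2 = n ∧ D.Sub E H.1},
      H ∈ D.facetsBetween n E.1 G := fun E => ⟨E.2.2, hHG⟩
  -- `none` stands for `H` itself, `some E` for the other facet of `G` through `E`.
  refine ⟨fun o => o.elim H f, ?_, fun F hF => ?_⟩
  · rintro (_ | E) (_ | E') h
    · rfl
    · exact absurd h.symm (hfne E')
    · exact absurd h (hfne E)
    · have h : f E = f E' := h
      exact congrArg some (Subtype.ext (D.eq_of_codim_two hG E.2.1 E'.2.1 (hfne E) (hmem E) (hf E)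
        (hmem E') (h ▸ hf E')))
  · ext H'
    constructor
    · rintro ⟨_ | E, hE, rfl⟩
      · exact ⟨hF, hHG⟩
      · exact ⟨(hE E rfl).trans (hf E).1, (hf E).2⟩
    · intro hH'
      by_cases hne : H' = H
      · exact ⟨none, by simp, hne.symm⟩
      · obtain ⟨E, hdE, hFE, hEH, hEH'⟩ := D.exists_codim_two hG ⟨hF, hHG⟩ hH' hne
        let E₀ : {E : D.Cell // D.dim E + 2 = n ∧ D.Sub E H.1} := ⟨E, hdE, hEH⟩
        refine ⟨some E₀, fun E' h => Option.some.inj h ▸ hFE, ?_⟩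
        -- Otherwise three distinct facets of `G` would contain the codimension-two cell `E`.
        by_contra hne'
        have hsub : ({f E₀, H', H} : Set (D.Facet n)) ⊆ D.facetsBetween n E G := by
          rintro _ (rfl | rfl | rfl)
          exacts [hf E₀, ⟨hEH', hH'.2⟩, hmem E₀]
        have hle := ncard_le_ncard hsub
        rw [hcard E₀, ncard_eq_three.2 ⟨f E₀, H', H, hne', hfne E₀, hne, rfl⟩] at hle
        omega

theorem exists_perm_facets (hD : D.IsPseudoManifold n) (H : D.Facet n) :
    ∃ (ψ : D.Cell → Equiv.Perm (D.Facet n)) (S : D.Cell → Set (D.Facet n)),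
      ∀ F G, D.Sub F H.1 → D.dim G = n → D.Sub H.1 G →
        ψ G '' S F = D.facetsBetween n F G := by
  obtain ⟨G₀, hG₀, hHG₀⟩ := hD.exists_top H.1
  obtain ⟨e₀, he₀, hS⟩ := D.exists_facets_param H hG₀ hHG₀
  have : ∀ G, ∃ ψ : Equiv.Perm (D.Facet n), D.dim G = n → D.Sub H.1 G →
      ∀ F, D.Sub F H.1 → ψ '' D.facetsBetween n F G₀ = D.facetsBetween n F G := by
    intro G
    by_cases h : D.dim G = n ∧ D.Sub H.1 G
    · obtain ⟨e, he, hS'⟩ := D.exists_facets_param H h.1 h.2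
      obtain ⟨ψ, hψ⟩ := exists_perm_apply_eq he₀ he
      refine ⟨ψ, fun _ _ F hF => ?_⟩
      rw [← hS F hF, ← hS' F hF, image_image]
      simp only [hψ]
    -- A filler value: no gluing along `H` involves such a `G`.
    · exact ⟨1, fun h₁ h₂ => absurd ⟨h₁, h₂⟩ h⟩
  choose ψ hψ using this
  exact ⟨ψ, fun F => D.facetsBetween n F G₀, fun F G hF hG hHG => hψ G hG hHG F hF⟩

theorem nonempty_facetCover (hD : D.IsPseudoManifold n) : Nonempty (D.FacetCover n) := by
  choose ψ S hψ using D.exists_perm_facets hD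
  have := D.finite_cell
  refine ⟨{
    Sheet := {G : D.Cell // D.dim G = n} × Equiv.Perm (D.Facet n)
    finite_sheet := inferInstance
    top := fun t => t.1.1
    dim_top := fun t => t.1.2
    exists_top := fun G hG => ⟨(⟨G, hG⟩, 1), rfl⟩
    Rel := fun H t s => D.Sub H.1 t.1.1 ∧ D.Sub H.1 s.1.1 ∧
      (ψ H t.1.1).trans t.2 = (ψ H s.1.1).trans s.2
    sub_top := fun h => h.1
    symm := fun h => ⟨h.2.1, h.1, h.2.2.symm⟩
    trans := fun h h' => ⟨h.1, h'.2.1, h.2.2.trans h'.2.2⟩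
    lift := ?_
    eq_of_rel := ?_
    Label := D.Facet n
    finite_label := inferInstance
    label := fun t H => t.2 H
    label_injOn := fun t => t.2.injective.injOn
    image_label_eq := ?_ }⟩
  · intro H t G ht hG hHG
    -- The gluing equation leaves no choice: the labeling on `G` is `t.2 ∘ ψ H t.1.1 ∘ (ψ H G)⁻¹`.
    refine ⟨(⟨G, hG⟩, (ψ H G).symm.trans ((ψ H t.1.1).trans t.2)), rfl, ht, hHG, ?_⟩
    ext x
    simp
  · rintro H ⟨G, a⟩ ⟨G', b⟩ ⟨-, -, h⟩ hG
    obtain rfl : G = G' := Subtype.ext hG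
    refine Prod.ext rfl (Equiv.ext fun x => ?_)
    simpa using DFunLike.congr_fun h ((ψ H G.1).symm x)
  · rintro H t s F ⟨h₁, h₂, h⟩ hF
    -- Both label sets are images of the same set `S H F`, under permutations that the gluing
    -- equates.
    rw [← hψ H F _ hF t.1.2 h₁, ← hψ H F _ hF s.1.2 h₂, image_image, image_image]
    exact congrArg (fun e : Equiv.Perm (D.Facet n) => e '' S H F) h

end

/-! ### Connected components of a facet cover -/

namespace FacetCover

variable {X : Type*} [TopologicalSpace X] {D : SimpleCellDecomposition X} {n : ℕ}
  (C : D.FacetCover n)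

/-- Two sheets are adjacent if they are glued along some facet. -/
def Adj (t s : C.Sheet) : Prop := ∃ H, C.Rel H t s

/-- The connected component of a sheet, provided it covers all `n`-dimensional cells. -/
def component (t₀ : C.Sheet)
    (h : ∀ G, D.dim G = n → ∃ t, Relation.ReflTransGen C.Adj t₀ t ∧ C.top t = G) :
    D.FacetCover n where
  Sheet := {t : C.Sheet // Relation.ReflTransGen C.Adj t₀ t}
  finite_sheet :=
    have := C.finite_sheet
    inferInstance
  top t := C.top t.1
  dim_top t := C.dim_top t.1
  exists_top G hG := by
    obtain ⟨t, ht, rfl⟩ := h G hG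
    exact ⟨⟨t, ht⟩, rfl⟩
  Rel H t s := C.Rel H t.1 s.1
  sub_top h := C.sub_top h
  symm h := C.symm h
  trans h h' := C.trans h h'
  lift {H t G} ht hG hHG := by
    obtain ⟨s, hs, hts⟩ := C.lift ht hG hHG
    exact ⟨⟨s, t.2.tail ⟨H, hts⟩⟩, hs, hts⟩
  eq_of_rel h h' := Subtype.ext (C.eq_of_rel h h')
  Label := C.Label
  finite_label := C.finite_label
  label t := C.label t.1
  label_injOn t := C.label_injOn t.1
  image_label_eq h hF := C.image_label_eq h hF

theorem reflTransGen_component (t₀ : C.Sheet)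
    (h : ∀ G, D.dim G = n → ∃ t, Relation.ReflTransGen C.Adj t₀ t ∧ C.top t = G)
    (t s : (C.component t₀ h).Sheet) :
    Relation.ReflTransGen (C.component t₀ h).Adj t s := by
  have key : ∀ t (ht : Relation.ReflTransGen C.Adj t₀ t),
      Relation.ReflTransGen (C.component t₀ h).Adj ⟨t₀, .refl⟩ ⟨t, ht⟩ := by
    intro t ht
    induction ht with
    | refl => exact .refl
    | tail ht hts ih => exact ih.tail hts
  have hsymm : Std.Symm (C.component t₀ h).Adj :=
    ⟨fun _ _ ⟨H, hH⟩ => ⟨H, (C.component t₀ h).symm hH⟩⟩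
  exact (Std.Symm.symm (r := Relation.ReflTransGen (C.component t₀ h).Adj) _ _
    (key t.1 t.2)).trans (key s.1 s.2)

/-- Chains of adjacent `n`-cells lift to chains of glued sheets, so the component of any sheet
already reaches every `n`-cell. -/
theorem exists_connected (C : D.FacetCover n) (hconn : D.IsStronglyConnected n) :
    ∃ C' : D.FacetCover n, ∀ t s, Relation.ReflTransGen C'.Adj t s := by
  rcases isEmpty_or_nonempty C.Sheet with hE | ⟨⟨t₀⟩⟩
  · exact ⟨C, fun t => hE.elim t⟩
  · have h : ∀ G, D.dim G = n → ∃ t, Relation.ReflTransGen C.Adj t₀ t ∧ C.top t = G := by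
      intro G hG
      induction hconn _ G (C.dim_top t₀) hG with
      | refl => exact ⟨t₀, .refl, rfl⟩
      | tail _ hstep ih =>
        obtain ⟨hA, hB, H, hH, hHA, hHB⟩ := hstep
        obtain ⟨t, ht, rfl⟩ := ih hA
        obtain ⟨s, hs, hts⟩ := C.lift (H := ⟨H, hH⟩) hHA hB hHB
        exact ⟨s, ht.tail ⟨_, hts⟩, hs⟩
    exact ⟨C.component t₀ h, C.reflTransGen_component t₀ h⟩

end FacetCover

end SimpleCellDecomposition

theorem mainTheorem3 {Z : Type u} [TopologicalSpace Z] [T2Space Z] (n : ℕ)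
    (D : SimpleCellDecomposition Z) (hD : D.IsPseudoManifold n) :
    ∃ (Z' : Type u) (_ : TopologicalSpace Z') (_ : T2Space Z')
      (D' : SimpleCellDecomposition Z') (p : Z' → Z),
      D'.IsPseudoManifold n ∧
      (D.IsStronglyConnected n → D'.IsStronglyConnected n) ∧
      (∃ (α : Type) (_ : Finite α) (l : D'.Facet n → α),
        SimpleCellDecomposition.IsGoodLabeling l) ∧
      Continuous p ∧ Function.Surjective p ∧
      IsCoveringMapOn p (D.codimTwoSkeleton n)ᶜ ∧
      ∀ F' : D'.Cell, ∃ F : D.Cell, SimpleCell.MapsIso p (D'.cell F') (D.cell F) := by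
  obtain ⟨C₀⟩ := D.nonempty_facetCover hD
  obtain ⟨C, hC⟩ : ∃ C : D.FacetCover n, D.IsStronglyConnected n →
      ∀ t s, Relation.ReflTransGen C.Adj t s := by
    by_cases hconn : D.IsStronglyConnected n
    · obtain ⟨C, hC⟩ := C₀.exists_connected hconn
      exact ⟨C, fun _ => hC⟩
    · exact ⟨C₀, fun h => absurd h hconn⟩
  exact ⟨C.Space, inferInstance, inferInstance, C.decomposition, C.proj,
    C.isPseudoManifold_decomposition hD,
    fun h => C.isStronglyConnected_decomposition (hC h),
    ⟨C.Label, C.finite_label, C.facetLabel, C.isGoodLabeling_facetLabel⟩,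
    C.continuous_proj, C.surjective_proj hD, C.isCoveringMapOn_proj hD,
    fun c => ⟨_, C.mapsIso_proj c⟩⟩
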